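/- Let $\mathcal U=\{\uparrow,\rightarrow\}$ and let $U=(U_{i,n})_{i\in\mathbb Z,n\in\mathbb N}$ be i.i.d. uniform on $\mathcal U$. For a one-step map $\mathcal F$ and a probability measure $\mu$ on configurations, the model with initial law $\mu$ is $X_0\sim\mu$, independent of $U$, $X_{n+1}=\mathcal F(X_n,(U_{i,n})_{i\in\mathbb Z})$. Model $A$ (on $\{0,1\}^{\mathbb Z}$): $\mathcal A(x,u)_i=0$ if $x_{i-1}x_i=01$, or $x_{i-1}x_i=00$ and $u_i=\rightarrow$, or $x_{i-1}x_i=11$ and $u_i=\uparrow$; otherwise $\mathcal A(x,u)_i=1$. Models $B$ and $C$ (on $\{\circ,\bullet\}^{\mathbb Z}$, where $\bullet$ is a particle and $\circ$ an empty site): at each time step the particle at site $i$, if any, stays if $u_i=\uparrow$ and jumps to $i+1$ if $u_i=\rightarrow$; two particles arriving at the same site annihilate in model $B$ and merge into one particle in model $C$. For $n\ge 0$, let $d_n$ be the probability that site $0$ holds a particle at time $n$ in model $C$ started from the full configuration $\bullet^{\mathbb Z}$, and let $$d_n^A=\sup_{\mu}\ \mathbb P\bigl(A_{0,n}A_{1,n}\in\{00,11\}\bigr),$$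 where $\mu$ ranges over all probability measures on $\{0,1\}^{\mathbb Z}$ and $(A_n)_n$ is model $A$ with initial law $\mu$. Then: 1. the supremum is attained, and $d_n^A=\max_\nu \mathbb P(B_{0,n}=\bullet)$, the maximum being over all probability measures $\nu$ on $\{\circ,\bullet\}^{\mathbb Z}$, where $(B_n)_n$ is model $B$ with initial law $\nu$; 2. $d_n=4^{-n}\binom{2n+1}{n}$; 3. $d_n^A\le d_n$ for every $n\ge 0$, and $\tfrac12 d_{n-1}\le d_n^A$ for every $n\ge 1$; moreover, for $n\ge1$, if model $A$ is started from the constant configuration $1^{\mathbb Z}$, then $\mathbb P(A_{0,n}A_{1,n}\in\{00,11\})=\tfrac12 d_{n-1}$. -/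

import Mathlib

open MeasureTheory

namespace PCA

/-- The two values of an update variable: stay at the site, or jump to the site on its right
(for model A: switch, respectively keep). -/
inductive Move
  | up
  | right
  deriving DecidableEq

/-- The alphabet of the particle systems: an empty site, or a site holding one particle. -/
inductive Cell
  | empty
  | particle
  deriving DecidableEq

instance : MeasurableSpace Move := ⊤
instance : MeasurableSpace Cell := ⊤
instance : DiscreteMeasurableSpace Move := ⟨fun _ => trivial⟩
instance : DiscreteMeasurableSpace Cell := ⟨fun _ => trivial⟩
instance : Fintype Move := ⟨{Move.up, Move.right}, fun m => by cases m <;> decide⟩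
instance : Nonempty Move := ⟨Move.up⟩

/-- One time step of model A. -/
def stepA (x : ℤ → Fin 2) (u : ℤ → Move) : ℤ → Fin 2 := fun i =>
  if (x (i - 1) = 0 ∧ x i = 1) ∨
      (x (i - 1) = 0 ∧ x i = 0 ∧ u i = Move.right) ∨
      (x (i - 1) = 1 ∧ x i = 1 ∧ u i = Move.up)
  then 0 else 1

/-- One time step of model B: particles annihilate when they meet. -/
def stepB (y : ℤ → Cell) (u : ℤ → Move) : ℤ → Cell := fun i =>
  if (y (i - 1) = Cell.particle ∧ y i = Cell.empty ∧ u (i - 1) = Move.right) ∨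
      (y (i - 1) = Cell.empty ∧ y i = Cell.particle ∧ u i = Move.up) ∨
      (y (i - 1) = Cell.particle ∧ y i = Cell.particle ∧
        u (i - 1) = Move.up ∧ u i = Move.up) ∨
      (y (i - 1) = Cell.particle ∧ y i = Cell.particle ∧
        u (i - 1) = Move.right ∧ u i = Move.right)
  then Cell.particle else Cell.empty

/-- One time step of model C: particles merge when they meet. -/
def stepC (z : ℤ → Cell) (u : ℤ → Move) : ℤ → Cell := fun i =>
  if (z (i - 1) = Cell.particle ∧ z i = Cell.empty ∧ u (i - 1) = Move.right) ∨
      (z (i - 1) = Cell.empty ∧ z i = Cell.particle ∧ u i = Move.up) ∨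
      (z (i - 1) = Cell.particle ∧ z i = Cell.particle ∧
        u (i - 1) = Move.up ∧ u i = Move.up) ∨
      (z (i - 1) = Cell.particle ∧ z i = Cell.particle ∧ u (i - 1) = Move.right)
  then Cell.particle else Cell.empty

/-- The trajectory started from `x` and driven by the updates `u`; the update of site `i` between
the times `n` and `n + 1` is `u (i, n)`. -/
def trajectory {S : Type} (step : (ℤ → S) → (ℤ → Move) → (ℤ → S))
    (x : ℤ → S) (u : ℤ × ℕ → Move) : ℕ → (ℤ → S)
  | 0 => x
  | n + 1 => step (trajectory step x u n) (fun i => u (i, n))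

/-- The law of the update process: independent fair coins indexed by space-time. -/
noncomputable def updateLaw : Measure (ℤ × ℕ → Move) :=
  Measure.infinitePi fun _ => (PMF.uniformOfFintype Move).toMeasure

/-- The probability that the sites `0` and `1` are in the same state (`00` or `11`) at time `n`,
for model A with initial law `μ` and an update process independent of the initial state. -/
noncomputable def equalPairProb (μ : ProbabilityMeasure (ℤ → Fin 2)) (n : ℕ) : ℝ :=
  ((μ : Measure (ℤ → Fin 2)).prod updateLaw).real
    {ω | (trajectory stepA ω.1 ω.2 n 0 = 0 ∧ trajectory stepA ω.1 ω.2 n 1 = 0) ∨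
      (trajectory stepA ω.1 ω.2 n 0 = 1 ∧ trajectory stepA ω.1 ω.2 n 1 = 1)}

/-- The probability that site `0` holds a particle at time `n`, for the particle system with the
given one-step map, initial law `ν` and an update process independent of the initial state. -/
noncomputable def particleProb (step : (ℤ → Cell) → (ℤ → Move) → (ℤ → Cell))
    (ν : ProbabilityMeasure (ℤ → Cell)) (n : ℕ) : ℝ :=
  ((ν : Measure (ℤ → Cell)).prod updateLaw).real
    {ω | trajectory step ω.1 ω.2 n 0 = Cell.particle}

/-- The Dirac mass at a configuration. -/
noncomputable def pointMass {S : Type} [MeasurableSpace S] (x : ℤ → S) :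
    ProbabilityMeasure (ℤ → S) :=
  ⟨Measure.dirac x, inferInstance⟩

/-- The density of particles at time `n` for model C started from the full configuration. -/
noncomputable def densityC (n : ℕ) : ℝ :=
  particleProb stepC (pointMass fun _ => Cell.particle) n

/-- The supremum over all initial laws, for model A, of the probability of seeing `00` or `11` at
the sites `0`, `1` at time `n`. -/
noncomputable def speedA (n : ℕ) : ℝ :=
  ⨆ μ : ProbabilityMeasure (ℤ → Fin 2), equalPairProb μ n

end PCA

/-! Model A copies its left neighbour on `right` and flips on `up`. Its pairs of equal neighbours
therefore evolve as the particles of model B, up to a unit shift of the coins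
(`equalPairs_trajectory`). Every particle configuration arises in this way (`exists_equalPairs_eq`),
and time `n` sees only finitely many initial sites, so both maxima are one finite maximum over
deterministic starts. With the same coins, B stays below C started full. The densities come from
duality: boundaries followed backward perform independent lazy walks until they meet. In C, an
interval is occupied iff its two boundaries have not met (`exists_particle_succ_iff`); in A, a
parity-corrected state is transported along them (`height_stepA`). Both cases reduce to the survival
probability of a walk killed at 0 (`updateLaw_eq_walkCount`). -/

namespace PCA

open ProbabilityTheory

/-! ### Local dynamics: measurability and finite dependence -/

/-- A one-step map under which the new state of a site is a function of the states and of the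
update variables of the site and of its left neighbour. -/
def IsLocal {S : Type} (step : (ℤ → S) → (ℤ → Move) → (ℤ → S)) : Prop :=
  ∃ F : (S × S) × (Move × Move) → S,
    ∀ x u i, step x u i = F ((x (i - 1), x i), (u (i - 1), u i))

lemma isLocal_stepA : IsLocal stepA :=
  ⟨fun p => if (p.1.1 = 0 ∧ p.1.2 = 1) ∨ (p.1.1 = 0 ∧ p.1.2 = 0 ∧ p.2.2 = Move.right) ∨
      (p.1.1 = 1 ∧ p.1.2 = 1 ∧ p.2.2 = Move.up) then 0 else 1, fun _ _ _ => rfl⟩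

lemma isLocal_stepB : IsLocal stepB :=
  ⟨fun p => stepB (fun j => if j = 0 then p.1.2 else p.1.1)
    (fun j => if j = 0 then p.2.2 else p.2.1) 0, fun _ _ _ => by simp [stepB]⟩

lemma isLocal_stepC : IsLocal stepC :=
  ⟨fun p => stepC (fun j => if j = 0 then p.1.2 else p.1.1)
    (fun j => if j = 0 then p.2.2 else p.2.1) 0, fun _ _ _ => by simp [stepC]⟩

instance : Countable Move := Finite.to_countable
instance : Fintype Cell := ⟨{Cell.empty, Cell.particle}, fun m => by cases m <;> decide⟩

/-- Only the coins before time `n` need be measurable, so this also applies with the σ-algebra `past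
n`. -/
lemma measurable_trajectory {Ω : Type*} [MeasurableSpace Ω] {S : Type} [MeasurableSpace S]
    [DiscreteMeasurableSpace S] [Countable S] {step : (ℤ → S) → (ℤ → Move) → (ℤ → S)}
    (hstep : IsLocal step) {X : Ω → ℤ → S} {U : Ω → ℤ × ℕ → Move}
    (hX : ∀ i, Measurable fun ω => X ω i) (n : ℕ)
    (hU : ∀ p : ℤ × ℕ, p.2 < n → Measurable fun ω => U ω p) (i : ℤ) :
    Measurable fun ω => trajectory step (X ω) (U ω) n i := by
  obtain ⟨F, hF⟩ := hstep
  induction n generalizing i with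
  | zero => exact hX i
  | succ n ih =>
    have ih' := ih fun p hp => hU p (hp.trans n.lt_succ_self)
    simp only [trajectory, hF]
    exact (measurable_of_countable F).comp
      (((ih' _).prodMk (ih' _)).prodMk ((hU (_, n) n.lt_succ_self).prodMk
        (hU (_, n) n.lt_succ_self)))

lemma trajectory_congr {S : Type} {step : (ℤ → S) → (ℤ → Move) → (ℤ → S)}
    (hstep : IsLocal step) {x x' : ℤ → S} (u : ℤ × ℕ → Move) (n : ℕ) (i : ℤ)
    (h : ∀ j, i - n ≤ j → j ≤ i → x j = x' j) :
    trajectory step x u n i = trajectory step x' u n i := by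
  obtain ⟨F, hF⟩ := hstep
  induction n generalizing i with
  | zero => exact h i (by simp) le_rfl
  | succ n ih =>
    simp only [trajectory, hF]
    rw [ih (i - 1) fun j h1 h2 => h j (by push_cast; linarith) (by linarith),
      ih i fun j h1 h2 => h j (by push_cast; linarith) (by linarith)]

/-! ### Coins of one time level and independence of the past -/

instance : IsProbabilityMeasure updateLaw := by
  unfold updateLaw; infer_instance

lemma uniform_move_singleton (m : Move) :
    (PMF.uniformOfFintype Move).toMeasure {m} = 2⁻¹ := by
  rw [PMF.toMeasure_apply_singleton _ _ (MeasurableSet.singleton m)]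
  simp [PMF.uniformOfFintype_apply]
  rfl

lemma updateLaw_pair {p q : ℤ × ℕ} (hpq : p ≠ q) (m m' : Move) :
    updateLaw.real {u | u p = m ∧ u q = m'} = 1 / 4 := by
  have h := Measure.infinitePi_pi (fun _ : ℤ × ℕ => (PMF.uniformOfFintype Move).toMeasure)
    (s := {p, q}) (t := fun r => if r = p then {m} else {m'}) fun _ _ => trivial
  rw [Finset.prod_pair hpq, if_pos rfl, if_neg hpq.symm, uniform_move_singleton,
    uniform_move_singleton] at h
  have hs : {u : ℤ × ℕ → Move | u p = m ∧ u q = m'}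
      = Set.pi (({p, q} : Finset (ℤ × ℕ)) : Set (ℤ × ℕ))
        (fun r => if r = p then {m} else {m'}) := by
    ext u
    simp [hpq.symm]
  rw [Measure.real, hs, updateLaw, h]
  simp
  norm_num

/-- The `σ`-algebra generated by the updates before time `n`. -/
@[reducible] def past (n : ℕ) : MeasurableSpace (ℤ × ℕ → Move) :=
  ⨆ p ∈ {p : ℤ × ℕ | p.2 < n}, MeasurableSpace.comap (fun u => u p) inferInstance

lemma past_le (n : ℕ) : past n ≤ MeasurableSpace.pi :=
  iSup₂_le fun p _ => (measurable_pi_apply p).comap_le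

lemma measurable_past {n : ℕ} {p : ℤ × ℕ} (hp : p.2 < n) :
    Measurable[past n] fun u : ℤ × ℕ → Move => u p :=
  Measurable.of_comap_le
    (le_iSup₂_of_le (f := fun (p : ℤ × ℕ) (_ : p ∈ {p : ℤ × ℕ | p.2 < n}) =>
      MeasurableSpace.comap (fun u : ℤ × ℕ → Move => u p) inferInstance) p hp le_rfl)

lemma updateLaw_past_inter_pair {n : ℕ} {G : Set (ℤ × ℕ → Move)} (hG : MeasurableSet[past n] G)
    {a b : ℤ} (hab : a ≠ b) (m m' : Move) :
    updateLaw.real (G ∩ {u | u (a, n) = m ∧ u (b, n) = m'}) = 1 / 4 * updateLaw.real G := by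
  have hind : iIndepFun (fun (p : ℤ × ℕ) (u : ℤ × ℕ → Move) => u p) updateLaw :=
    iIndepFun_infinitePi (X := fun _ => id) fun _ => measurable_id
  have hd : Disjoint {p : ℤ × ℕ | p.2 < n} {(a, n), (b, n)} := by
    rw [Set.disjoint_left]
    rintro p hp (rfl | rfl) <;> exact absurd hp (lt_irrefl n)
  have h := indep_iSup_of_disjoint (fun p => (measurable_pi_apply p).comap_le) hind.iIndep hd
  have hp : ∀ p ∈ ({(a, n), (b, n)} : Set (ℤ × ℕ)), ∀ m : Move,
      MeasurableSet[⨆ p ∈ ({(a, n), (b, n)} : Set (ℤ × ℕ)),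
        MeasurableSpace.comap (fun u : ℤ × ℕ → Move => u p) inferInstance] {u | u p = m} := by
    intro p hp m
    exact le_iSup₂ (f := fun (p : ℤ × ℕ) (_ : p ∈ ({(a, n), (b, n)} : Set (ℤ × ℕ))) =>
      MeasurableSpace.comap (fun u : ℤ × ℕ → Move => u p) inferInstance) p hp _
      ⟨{m}, trivial, rfl⟩
  have := (Indep_iff _ _ _).1 h G {u | u (a, n) = m ∧ u (b, n) = m'} hG
    (MeasurableSet.inter (hp _ (by simp) m) (hp _ (by simp) m'))
  rw [Measure.real, this, ENNReal.toReal_mul, mul_comm]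
  congr 1
  exact updateLaw_pair (by simpa using hab) m m'

/-! ### Dual boundaries and the walk killed at zero -/

/-- One backward step of a boundary between two sites, through the updates of time `n`. -/
def dualStep (n : ℕ) (u : ℤ × ℕ → Move) (c : ℤ) : ℤ :=
  if u (c - 1, n) = Move.right then c - 1 else c

/-- Distinct boundaries read distinct coins, which are independent of `past n`; the four outcomes
are equally likely. -/
lemma updateLaw_dualStep {n : ℕ} {G : ℤ → ℤ → Set (ℤ × ℕ → Move)}
    (hG : ∀ a b, MeasurableSet[past n] (G a b)) {a b : ℤ} (hab : a ≠ b) :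
    updateLaw.real {u | u ∈ G (dualStep n u a) (dualStep n u b)} =
      1 / 4 * (updateLaw.real (G (a - 1) (b - 1)) + updateLaw.real (G (a - 1) b) +
        updateLaw.real (G a (b - 1)) + updateLaw.real (G a b)) := by
  have hm : ∀ p : ℤ × ℕ, MeasurableSet {u : ℤ × ℕ → Move | u p = Move.right} := fun p =>
    measurableSet_eq_fun (measurable_pi_apply p) measurable_const
  have hab' : a - 1 ≠ b - 1 := fun h => hab (by linarith)
  have e1 := updateLaw_past_inter_pair (hG (a - 1) (b - 1)) hab' Move.right Move.right
  have e2 := updateLaw_past_inter_pair (hG (a - 1) b) hab' Move.right Move.up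
  have e3 := updateLaw_past_inter_pair (hG a (b - 1)) hab' Move.up Move.right
  have e4 := updateLaw_past_inter_pair (hG a b) hab' Move.up Move.up
  have key : ∀ {s t : Set (ℤ × ℕ → Move)} {c : ℝ}, updateLaw.real s = c →
      t = s → updateLaw.real t = c := fun h h' => h' ▸ h
  set H := {u | u ∈ G (dualStep n u a) (dualStep n u b)} with hH
  set L := {u : ℤ × ℕ → Move | u (a - 1, n) = Move.right} with hL
  set R := {u : ℤ × ℕ → Move | u (b - 1, n) = Move.right} with hR
  have k1 := key (t := H ∩ L ∩ R) e1 <| by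
    ext u
    rcases h1 : u (a - 1, n) <;> rcases h2 : u (b - 1, n) <;>
      simp [hH, hL, hR, dualStep, h1, h2]
  have k2 := key (t := (H ∩ L) \ R) e2 <| by
    ext u
    rcases h1 : u (a - 1, n) <;> rcases h2 : u (b - 1, n) <;>
      simp [hH, hL, hR, dualStep, h1, h2]
  have k3 := key (t := (H \ L) ∩ R) e3 <| by
    ext u
    rcases h1 : u (a - 1, n) <;> rcases h2 : u (b - 1, n) <;>
      simp [hH, hL, hR, dualStep, h1, h2]
  have k4 := key (t := (H \ L) \ R) e4 <| by
    ext u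
    rcases h1 : u (a - 1, n) <;> rcases h2 : u (b - 1, n) <;>
      simp [hH, hL, hR, dualStep, h1, h2]
  rw [← measureReal_inter_add_sdiff (s := H) (hm (a - 1, n)),
    ← measureReal_inter_add_sdiff (s := H ∩ L) (hm (b - 1, n)),
    ← measureReal_inter_add_sdiff (s := H \ L) (hm (b - 1, n)), k1, k2, k3, k4]
  ring

/-- The number of paths of the walk with `2 * n` half steps that start at `k` and end on the
positive side, minus those that end on the negative side. -/
def walkCount (n k : ℕ) : ℕ := ∑ m ∈ Finset.range k, (2 * n + 1).choose (n + 1 + m)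

/-- The distance changes by -1, 0, 0, +1. Two uses of Pascal's rule give the recursion; at `k = 0`
the symmetry of the central binomials accounts for the absorption at 0. -/
lemma walkCount_succ (n k : ℕ) :
    walkCount (n + 1) (k + 1) = walkCount n k + 2 * walkCount n (k + 1) + walkCount n (k + 2) := by
  induction k with
  | zero =>
    simp only [walkCount, Finset.sum_range_succ, Finset.sum_range_zero]
    have h1 : (2 * (n + 1) + 1).choose (n + 1 + 1 + 0) = (2 * n + 1).choose n +
        2 * (2 * n + 1).choose (n + 1) + (2 * n + 1).choose (n + 2) := by
      rw [show 2 * (n + 1) + 1 = 2 * n + 1 + 1 + 1 by ring]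
      simp only [Nat.choose_succ_succ', add_zero]
      ring
    have h2 : (2 * n + 1).choose n = (2 * n + 1).choose (n + 1) :=
      (Nat.choose_symm_half n).symm
    rw [h1, h2]
    simp only [add_zero, zero_add, add_assoc, Nat.reduceAdd]
    ring
  | succ k ih =>
    have h : ∀ n k, walkCount n (k + 1) = walkCount n k + (2 * n + 1).choose (n + 1 + k) :=
      fun n k => Finset.sum_range_succ _ _
    have h1 : (2 * (n + 1) + 1).choose (n + 1 + 1 + (k + 1)) = (2 * n + 1).choose (n + 1 + k) +
        2 * (2 * n + 1).choose (n + 1 + (k + 1)) + (2 * n + 1).choose (n + 1 + (k + 2)) := by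
      rw [show 2 * (n + 1) + 1 = 2 * n + 1 + 1 + 1 by ring,
        show n + 1 + 1 + (k + 1) = n + 1 + k + 1 + 1 by ring]
      simp only [Nat.choose_succ_succ', ← add_assoc]
      ring
    rw [h (n + 1) (k + 1), ih, h1, h n (k + 2), h n (k + 1), h n k]
    ring

/-- By the reflection principle, `walkCount n k` counts the paths from distance `k` that avoid 0.
The start time `n₀` is free because in model A the probability becomes the same for all `a < b` only
at time 1. -/
lemma updateLaw_eq_walkCount {G : ℕ → ℤ → ℤ → Set (ℤ × ℕ → Move)} {n₀ : ℕ} {c : ℝ}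
    (hG : ∀ n a b, MeasurableSet[past n] (G n a b))
    (hstep : ∀ n a b, a < b →
      G (n + 1) a b = {u | u ∈ G n (dualStep n u a) (dualStep n u b)})
    (hself : ∀ n a, G n a a = ∅)
    (hinit : ∀ a b, a < b → updateLaw.real (G n₀ a b) = c) (n k : ℕ) (a : ℤ) :
    updateLaw.real (G (n₀ + n) a (a + k)) = c * (((4 : ℝ) ^ n)⁻¹ * walkCount n k) := by
  induction n generalizing k a with
  | zero =>
    rcases k with _ | k
    · simp [hself, walkCount]
    · have h1 : ∀ k, walkCount 0 (k + 1) = 1 := by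
        intro k
        simp only [walkCount, Finset.sum_range_succ', Nat.mul_zero, zero_add, add_zero,
          Nat.choose_self, Nat.add_eq_right, Finset.sum_eq_zero_iff]
        exact fun i _ => Nat.choose_eq_zero_of_lt (by omega)
      rw [add_zero, hinit _ _ (by push_cast; linarith), h1]
      simp
  | succ n ih =>
    rcases k with _ | k
    · simp [hself, walkCount]
    · rw [← add_assoc, hstep _ _ _ (by push_cast; linarith),
        updateLaw_dualStep (hG _) (by push_cast; linarith), walkCount_succ]
      have e1 := ih (k + 1) (a - 1)
      have e2 := ih (k + 2) (a - 1)
      have e3 := ih k a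
      have e4 := ih (k + 1) a
      rw [show a - 1 + ((k + 1 : ℕ) : ℤ) = a + ((k + 1 : ℕ) : ℤ) - 1 by ring] at e1
      rw [show a - 1 + ((k + 2 : ℕ) : ℤ) = a + ((k + 1 : ℕ) : ℤ) by push_cast; ring] at e2
      rw [show a + (k : ℤ) = a + ((k + 1 : ℕ) : ℤ) - 1 by push_cast; ring] at e3
      rw [e1, e2, e3, e4]
      push_cast
      field_simp
      ring

/-! ### Shift invariance and reduction to deterministic starts -/

lemma updateLaw_map_shift :
    updateLaw.map (fun u (p : ℤ × ℕ) => u (p.1 + 1, p.2)) = updateLaw := by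
  have h := Measure.infinitePi_map_piCongrLeft
    (fun _ : ℤ × ℕ => (PMF.uniformOfFintype Move).toMeasure)
    ((Equiv.subRight (1 : ℤ)).prodCongr (Equiv.refl ℕ))
  have e : ⇑(MeasurableEquiv.piCongrLeft (fun _ : ℤ × ℕ => Move)
      ((Equiv.subRight (1 : ℤ)).prodCongr (Equiv.refl ℕ))) =
        fun u (p : ℤ × ℕ) => u (p.1 + 1, p.2) := by
    funext u p
    obtain ⟨q, rfl⟩ := ((Equiv.subRight (1 : ℤ)).prodCongr (Equiv.refl ℕ)).surjective p
    rw [MeasurableEquiv.coe_piCongrLeft, Equiv.piCongrLeft_apply_apply]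
    simp
  rwa [e] at h

lemma real_dirac_prod_updateLaw {Ω : Type*} [MeasurableSpace Ω] (x : Ω)
    {s : Set (Ω × (ℤ × ℕ → Move))} (hs : MeasurableSet s) :
    ((Measure.dirac x).prod updateLaw).real s = updateLaw.real (Prod.mk x ⁻¹' s) := by
  rw [Measure.dirac_prod, map_measureReal_apply measurable_prodMk_left hs]

lemma real_prod_updateLaw_le {Ω : Type*} [MeasurableSpace Ω] (μ : Measure Ω)
    [IsProbabilityMeasure μ] {s : Set (Ω × (ℤ × ℕ → Move))} (hs : MeasurableSet s) {c : ℝ}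
    (h : ∀ x, updateLaw.real (Prod.mk x ⁻¹' s) ≤ c) : (μ.prod updateLaw).real s ≤ c := by
  have hc : 0 ≤ c := by
    obtain ⟨x⟩ := μ.nonempty_of_neZero
    exact measureReal_nonneg.trans (h x)
  refine ENNReal.toReal_le_of_le_ofReal hc ?_
  rw [Measure.prod_apply hs]
  calc ∫⁻ x, updateLaw (Prod.mk x ⁻¹' s) ∂μ ≤ ∫⁻ _, ENNReal.ofReal c ∂μ :=
        lintegral_mono fun x => (ENNReal.le_ofReal_iff_toReal_le (measure_ne_top _ _) hc).2 (h x)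
    _ = ENNReal.ofReal c := by simp

/-- The probability that a particle system started from `y` has a particle at site `0` at
time `n`. -/
noncomputable def cellProb (step : (ℤ → Cell) → (ℤ → Move) → (ℤ → Cell)) (y : ℤ → Cell)
    (n : ℕ) : ℝ :=
  updateLaw.real {u | trajectory step y u n 0 = Cell.particle}

lemma measurable_trajectory_prod {S : Type} [MeasurableSpace S]
    [DiscreteMeasurableSpace S] [Countable S] {step : (ℤ → S) → (ℤ → Move) → (ℤ → S)}
    (hstep : IsLocal step) (n : ℕ) (i : ℤ) :
    Measurable fun ω : (ℤ → S) × (ℤ × ℕ → Move) => trajectory step ω.1 ω.2 n i :=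
  measurable_trajectory hstep (fun i => (measurable_pi_apply i).comp measurable_fst) n
    (fun p _ => (measurable_pi_apply p).comp measurable_snd) i

lemma measurable_trajectory_past {S : Type} [MeasurableSpace S]
    [DiscreteMeasurableSpace S] [Countable S] {step : (ℤ → S) → (ℤ → Move) → (ℤ → S)}
    (hstep : IsLocal step) (x : ℤ → S) (n : ℕ) (i : ℤ) :
    Measurable[past n] fun u : ℤ × ℕ → Move => trajectory step x u n i :=
  @measurable_trajectory _ (past n) _ _ _ _ _ hstep (fun _ => x) id
    (fun _ => @measurable_const _ _ _ (past n) _) n (fun _ hp => measurable_past hp) i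

lemma measurableSet_particle {step : (ℤ → Cell) → (ℤ → Move) → (ℤ → Cell)}
    (hstep : IsLocal step) (n : ℕ) :
    MeasurableSet {ω : (ℤ → Cell) × (ℤ × ℕ → Move) |
      trajectory step ω.1 ω.2 n 0 = Cell.particle} :=
  measurable_trajectory_prod hstep n 0 (MeasurableSet.singleton Cell.particle)

lemma particleProb_pointMass {step : (ℤ → Cell) → (ℤ → Move) → (ℤ → Cell)}
    (hstep : IsLocal step) (y : ℤ → Cell) (n : ℕ) :
    particleProb step (pointMass y) n = cellProb step y n :=
  real_dirac_prod_updateLaw y (measurableSet_particle hstep n)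

lemma measurableSet_equalPair (n : ℕ) :
    MeasurableSet {ω : (ℤ → Fin 2) × (ℤ × ℕ → Move) |
      (trajectory stepA ω.1 ω.2 n 0 = 0 ∧ trajectory stepA ω.1 ω.2 n 1 = 0) ∨
      (trajectory stepA ω.1 ω.2 n 0 = 1 ∧ trajectory stepA ω.1 ω.2 n 1 = 1)} := by
  have h := fun i j => measurable_trajectory_prod isLocal_stepA n i (MeasurableSet.singleton j)
  exact ((h 0 0).inter (h 1 0)).union ((h 0 1).inter (h 1 1))

lemma equalPair_iff (a b : Fin 2) : ((a = 0 ∧ b = 0) ∨ (a = 1 ∧ b = 1)) ↔ a = b := by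
  revert a b; decide

/-! ### From model A to model B -/

/-- The particles of a configuration of model A: the pairs of neighbouring sites in the same
state, located at the left one. -/
def equalPairs (x : ℤ → Fin 2) : ℤ → Cell := fun i =>
  if x i = x (i + 1) then Cell.particle else Cell.empty

lemma equalPairs_eq_particle (x : ℤ → Fin 2) (i : ℤ) :
    equalPairs x i = Cell.particle ↔ x i = x (i + 1) := by
  simp [equalPairs]

/-- Only equal pairs consult a coin, namely that of their right site; hence the shift by 1. The rest
is a finite check. -/
lemma equalPairs_stepA (x : ℤ → Fin 2) (u : ℤ → Move) :
    equalPairs (stepA x u) = stepB (equalPairs x) (fun i => u (i + 1)) := by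
  funext i
  simp only [equalPairs, stepA, stepB, sub_add_cancel, add_sub_cancel_right]
  generalize x (i - 1) = a
  generalize x i = b
  generalize x (i + 1) = c
  generalize u i = v
  generalize u (i + 1) = w
  revert a b c v w
  decide

lemma equalPairs_trajectory (x : ℤ → Fin 2) (u : ℤ × ℕ → Move) (n : ℕ) :
    equalPairs (trajectory stepA x u n) =
      trajectory stepB (equalPairs x) (fun p => u (p.1 + 1, p.2)) n := by
  induction n with
  | zero => rfl
  | succ n ih => simp only [trajectory, equalPairs_stepA, ih]

lemma equalPair_section (x : ℤ → Fin 2) (n : ℕ) :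
    updateLaw.real {u | (trajectory stepA x u n 0 = 0 ∧ trajectory stepA x u n 1 = 0) ∨
      (trajectory stepA x u n 0 = 1 ∧ trajectory stepA x u n 1 = 1)} =
      cellProb stepB (equalPairs x) n := by
  rw [cellProb]
  conv_rhs => rw [← updateLaw_map_shift]
  rw [map_measureReal_apply]
  · congr 1
    ext u
    rw [Set.mem_ofPred_eq, equalPair_iff, Set.mem_preimage, Set.mem_ofPred_eq,
      ← equalPairs_trajectory, equalPairs_eq_particle, zero_add]
  · exact measurable_pi_lambda _ fun p => measurable_pi_apply _
  · exact past_le n _ (measurable_trajectory_past isLocal_stepB _ n 0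
      (MeasurableSet.singleton Cell.particle))

lemma equalPairProb_pointMass (x : ℤ → Fin 2) (n : ℕ) :
    equalPairProb (pointMass x) n = cellProb stepB (equalPairs x) n :=
  (real_dirac_prod_updateLaw x (measurableSet_equalPair n)).trans (equalPair_section x n)

/-- The state is the parity of the number of empty cells between 0 and `i`, which changes exactly
across an empty cell. -/
lemma exists_equalPairs_eq (y : ℤ → Cell) : ∃ x, equalPairs x = y := by
  classical
  let f : ℤ → ℕ := fun i => ((Finset.Ico 0 i).filter fun j => y j = Cell.empty).card +
    ((Finset.Ico i 0).filter fun j => y j = Cell.empty).card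
  have hf : ∀ i, (Even (f i) ↔ Even (f (i + 1))) ↔ y i = Cell.particle := by
    intro i
    rcases lt_or_ge i 0 with hi | hi
    · have h1 : Finset.Ico 0 i = ∅ := Finset.Ico_eq_empty (by omega)
      have h2 : Finset.Ico 0 (i + 1) = ∅ := Finset.Ico_eq_empty (by omega)
      have h3 : Finset.Ico i 0 = insert i (Finset.Ico (i + 1) 0) := by
        ext j; simp only [Finset.mem_Ico, Finset.mem_insert]; omega
      simp only [f, h1, h2, h3, Finset.filter_insert]
      rcases hy : y i <;> simp [Nat.even_add_one, -Nat.not_even_iff_odd]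
    · have h1 : Finset.Ico i 0 = ∅ := Finset.Ico_eq_empty (by omega)
      have h2 : Finset.Ico (i + 1) 0 = ∅ := Finset.Ico_eq_empty (by omega)
      have h3 : Finset.Ico 0 (i + 1) = insert i (Finset.Ico 0 i) := by
        ext j; simp only [Finset.mem_Ico, Finset.mem_insert]; omega
      simp only [f, h1, h2, h3, Finset.filter_insert]
      rcases hy : y i <;> simp [Nat.even_add_one, -Nat.not_even_iff_odd]
  refine ⟨fun i => if Even (f i) then 0 else 1, funext fun i => ?_⟩
  have := hf i
  by_cases h1 : Even (f i) <;> by_cases h2 : Even (f (i + 1)) <;>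
    simp only [h1, h2, iff_self, true_iff, false_iff, iff_false, iff_true, not_true] at this <;>
    simp only [equalPairs, h1, h2, if_true, if_false]
  · simp [← this]
  · cases hy : y i <;> simp_all
  · cases hy : y i <;> simp_all
  · simp [this]

/-! ### Extremal initial configurations and comparison of B with C -/

lemma exists_cellProb_max {step : (ℤ → Cell) → (ℤ → Move) → (ℤ → Cell)} (hstep : IsLocal step)
    (n : ℕ) : ∃ y, ∀ y', cellProb step y' n ≤ cellProb step y n := by
  classical
  -- Only the sites from `-n` to 0 influence site 0 at time `n`, so finitely many configurations
  -- compete; the filling outside is irrelevant.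
  let ext : (Finset.Icc (-(n : ℤ)) 0 → Cell) → ℤ → Cell := fun z j =>
    if h : j ∈ Finset.Icc (-(n : ℤ)) 0 then z ⟨j, h⟩ else Cell.empty
  have : Nonempty Cell := ⟨Cell.empty⟩
  obtain ⟨z, hz⟩ := Finite.exists_max fun z => cellProb step (ext z) n
  refine ⟨ext z, fun y' => le_trans (le_of_eq ?_) (hz fun j => y' j)⟩
  unfold cellProb
  congr 1
  ext u
  rw [Set.mem_ofPred_eq, Set.mem_ofPred_eq]
  rw [trajectory_congr (x' := ext fun j => y' j) hstep u n 0]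
  intro j h1 h2
  have hj : j ∈ Finset.Icc (-(n : ℤ)) 0 := Finset.mem_Icc.2 ⟨by linarith, h2⟩
  simp only [ext, dif_pos hj]

lemma stepB_le_stepC {y z : ℤ → Cell} (u : ℤ → Move) {i : ℤ}
    (h1 : y (i - 1) = Cell.particle → z (i - 1) = Cell.particle)
    (h2 : y i = Cell.particle → z i = Cell.particle) (h : stepB y u i = Cell.particle) :
    stepC z u i = Cell.particle := by
  revert h h1 h2
  simp only [stepB, stepC]
  generalize y (i - 1) = a
  generalize y i = b
  generalize z (i - 1) = c
  generalize z i = d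
  generalize u (i - 1) = v
  generalize u i = w
  revert a b c d v w
  decide

lemma trajectory_stepB_le_stepC (y : ℤ → Cell) (u : ℤ × ℕ → Move) (n : ℕ) (i : ℤ)
    (h : trajectory stepB y u n i = Cell.particle) :
    trajectory stepC (fun _ => Cell.particle) u n i = Cell.particle := by
  induction n generalizing i with
  | zero => rfl
  | succ n ih => exact stepB_le_stepC _ (ih (i - 1)) (ih i) h

lemma cellProb_stepB_le_stepC (y : ℤ → Cell) (n : ℕ) :
    cellProb stepB y n ≤ cellProb stepC (fun _ => Cell.particle) n :=
  measureReal_mono (fun u hu => trajectory_stepB_le_stepC y u n 0 hu)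

/-! ### Density of model C by duality -/

lemma stepC_eq_particle (z : ℤ → Cell) (u : ℤ → Move) (i : ℤ) :
    stepC z u i = Cell.particle ↔ (z (i - 1) = Cell.particle ∧ u (i - 1) = Move.right) ∨
      (z i = Cell.particle ∧ u i = Move.up) := by
  simp only [stepC]
  generalize z (i - 1) = a
  generalize z i = b
  generalize u (i - 1) = v
  generalize u i = w
  revert a b v w
  decide

/-- Merging never empties an interval, so only crossings of its ends matter: the particle at `c - 1`
crosses the boundary `c` exactly when its coin is `right`. -/
lemma exists_particle_succ_iff (z : ℤ → Cell) (u : ℤ × ℕ → Move) (n : ℕ) (a b : ℤ) :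
    (∃ i, a ≤ i ∧ i < b ∧ stepC z (fun i => u (i, n)) i = Cell.particle) ↔
      ∃ i, dualStep n u a ≤ i ∧ i < dualStep n u b ∧ z i = Cell.particle := by
  simp only [stepC_eq_particle, dualStep]
  constructor
  · rintro ⟨i, hai, hib, ⟨hz, hu⟩ | ⟨hz, hu⟩⟩
    · refine ⟨i - 1, ?_, ?_, hz⟩
      · rcases eq_or_lt_of_le hai with rfl | h
        · simp [hu]
        · split_ifs <;> omega
      · split_ifs <;> omega
    · refine ⟨i, by split_ifs <;> omega, ?_, hz⟩
      split_ifs with h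
      · rcases eq_or_ne i (b - 1) with rfl | h'
        · simp [hu] at h
        · omega
      · exact hib
  · rintro ⟨j, haj, hjb, hz⟩
    rcases hu : u (j, n)
    · refine ⟨j, ?_, by split_ifs at hjb <;> omega, Or.inr ⟨hz, hu⟩⟩
      split_ifs at haj with h
      · rcases eq_or_ne j (a - 1) with rfl | h'
        · simp [hu] at h
        · omega
      · exact haj
    · refine ⟨j + 1, by split_ifs at haj <;> omega, ?_, Or.inl ?_⟩
      · split_ifs at hjb with h
        · omega
        · rcases eq_or_ne j (b - 1) with rfl | h'
          · exact absurd hu h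
          · omega
      · simpa using ⟨hz, hu⟩

lemma cellProb_stepC_full (n : ℕ) :
    cellProb stepC (fun _ => Cell.particle) n = ((4 : ℝ) ^ n)⁻¹ * walkCount n 1 := by
  -- The constant is 1 because every nonempty interval is occupied at time 0; site 0 is the interval
  -- from 0 to 1.
  have h := updateLaw_eq_walkCount (n₀ := 0) (c := 1) (G := fun n a b =>
    {u | ∃ i, a ≤ i ∧ i < b ∧ trajectory stepC (fun _ => Cell.particle) u n i = Cell.particle})
    (fun n a b => ?_) (fun n a b _ => ?_) (fun n a => ?_) (fun a b hab => ?_) n 1 0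
  · simp only [zero_add, one_mul] at h
    rw [← h, cellProb]
    congr 1
    ext u
    constructor
    · exact fun hu => ⟨0, by simp, by simp, hu⟩
    · rintro ⟨i, h0, h1, hi⟩
      obtain rfl : i = 0 := by push_cast at h1; omega
      exact hi
  · have : {u | ∃ i, a ≤ i ∧ i < b ∧
        trajectory stepC (fun _ => Cell.particle) u n i = Cell.particle} =
        ⋃ i ∈ Set.Ico a b, {u | trajectory stepC (fun _ => Cell.particle) u n i =
          Cell.particle} := by
      ext u; simp [and_assoc]
    rw [this]
    exact @MeasurableSet.biUnion _ _ (past n) _ _ (Set.to_countable _) fun i _ =>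
      measurable_trajectory_past isLocal_stepC _ n i (MeasurableSet.singleton _)
  · ext u
    exact exists_particle_succ_iff _ u n a b
  · ext u
    simp only [Set.mem_ofPred_eq, Set.mem_empty_iff_false, iff_false]
    rintro ⟨i, h0, h1, -⟩
    omega
  · have : {u : ℤ × ℕ → Move | ∃ i, a ≤ i ∧ i < b ∧
        trajectory stepC (fun _ => Cell.particle) u 0 i = Cell.particle} = Set.univ :=
      Set.eq_univ_of_forall fun u => ⟨a, le_rfl, hab, rfl⟩
    rw [this, probReal_univ]

/-! ### Model A from the constant configuration -/

/-- The state of model A on the left of the boundary `c`, corrected by the parity of space and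
time. -/
def height (x : ℤ → Fin 2) (n : ℕ) (c : ℤ) : Fin 2 :=
  x (c - 1) + (if Even (c + n) then 0 else 1)

lemma stepA_apply (x : ℤ → Fin 2) (u : ℤ → Move) (i : ℤ) :
    stepA x u i = if u i = Move.right then x (i - 1) else x i + 1 := by
  simp only [stepA]
  generalize x (i - 1) = a
  generalize x i = b
  generalize u i = v
  revert a b v
  decide

/-- A copy changes `c + n` by 2 and a flip changes it by 1, so the parity correction cancels exactly
the flips. -/
lemma height_stepA (x : ℤ → Fin 2) (u : ℤ × ℕ → Move) (n : ℕ) (c : ℤ) :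
    height (stepA x fun i => u (i, n)) (n + 1) c = height x n (dualStep n u c) := by
  have h0 : Even (c + ((n + 1 : ℕ) : ℤ)) ↔ ¬ Even (c + (n : ℤ)) := by
    rw [Nat.cast_succ, ← add_assoc, Int.even_add_one]
  have h1 : Even (c - 1 + (n : ℤ)) ↔ ¬ Even (c + (n : ℤ)) := by
    rw [show c + (n : ℤ) = c - 1 + n + 1 by ring, Int.even_add_one, not_not]
  simp only [height, stepA_apply, dualStep]
  by_cases hu : u (c - 1, n) = Move.right <;> by_cases he : Even (c + (n : ℤ)) <;>
    simp only [h0, h1, hu, he, if_true, if_false, not_true, not_false_eq_true] <;>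
    simp [add_assoc]

lemma updateLaw_equalPair_of_const_one (n : ℕ) :
    updateLaw.real {u | trajectory stepA (fun _ => 1) u (n + 1) 0 =
      trajectory stepA (fun _ => 1) u (n + 1) 1} =
      1 / 2 * (((4 : ℝ) ^ n)⁻¹ * walkCount n 1) := by
  let G : ℕ → ℤ → ℤ → Set (ℤ × ℕ → Move) := fun n a b =>
    {u | height (trajectory stepA (fun _ => 1) u n) n a ≠
      height (trajectory stepA (fun _ => 1) u n) n b}
  have hG : ∀ n a b, MeasurableSet[past n] (G n a b) := by
    intro n a b
    have hm : ∀ c, Measurable[past n] fun u =>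
        height (trajectory stepA (fun _ => 1) u n) n c := fun c =>
      (measurable_of_countable fun s : Fin 2 => s + if Even (c + (n : ℤ)) then 0 else 1).comp
        (measurable_trajectory_past isLocal_stepA (fun _ => 1) n (c - 1))
    exact ((hm a).prodMk (hm b)) (MeasurableSet.of_discrete (s := {p : Fin 2 × Fin 2 | p.1 ≠ p.2}))
  have hstep : ∀ n a b, G (n + 1) a b = {u | u ∈ G n (dualStep n u a) (dualStep n u b)} := by
    intro n a b
    ext u
    simp only [G, Set.mem_ofPred_eq, trajectory, height_stepA]
  have hself : ∀ n a, G n a a = ∅ := fun n a => by simp [G]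
  have h0 : ∀ a b : ℤ, updateLaw.real (G 0 a b) = if Even (b - a) then 0 else 1 := by
    intro a b
    by_cases ha : Even a <;> by_cases hb : Even b <;>
      simp [G, height, trajectory, Int.even_sub, ha, hb]
  -- Initially heights differ iff `b - a` is odd. Two of the four moves change this parity, so one
  -- step yields 1/2 at every distance.
  have h1 : ∀ a b : ℤ, a < b → updateLaw.real (G (0 + 1) a b) = 1 / 2 := by
    intro a b hab
    rw [hstep, updateLaw_dualStep (hG 0) hab.ne]
    simp only [h0]
    by_cases h : Even (b - a)
    · have h2 : ¬ Even (b - a + 1) := by simpa [Int.even_add_one] using h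
      have h3 : ¬ Even (b - a - 1) := by simpa [Int.even_sub_one] using h
      rw [show b - 1 - (a - 1) = b - a by ring, show b - (a - 1) = b - a + 1 by ring,
        show b - 1 - a = b - a - 1 by ring, if_pos h, if_neg h2, if_neg h3]
      norm_num
    · have h2 : Even (b - a + 1) := by simpa [Int.even_add_one] using h
      have h3 : Even (b - a - 1) := by simpa [Int.even_sub_one] using h
      rw [show b - 1 - (a - 1) = b - a by ring, show b - (a - 1) = b - a + 1 by ring,
        show b - 1 - a = b - a - 1 by ring, if_neg h, if_pos h2, if_pos h3]
      norm_num
  have h := updateLaw_eq_walkCount hG (fun n a b _ => hstep n a b) hself h1 n 1 1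
  rw [← h]
  congr 1
  ext u
  -- The boundaries 1 and 2 lie to the right of sites 0 and 1. Their corrections are opposite, so
  -- different heights mean equal states.
  have e1 : Even ((1 : ℤ) + ((0 + 1 + n : ℕ) : ℤ)) ↔ Even (n : ℤ) := by
    push_cast; simp [Int.even_add]
  have e2 : Even ((1 : ℤ) + ((1 : ℕ) : ℤ) + ((0 + 1 + n : ℕ) : ℤ)) ↔ ¬ Even (n : ℤ) := by
    push_cast; simp [Int.even_add]
  simp only [G, height, Set.mem_ofPred_eq, e1, e2]
  rw [show 0 + 1 + n = n + 1 by ring]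
  simp only [sub_self, Nat.cast_one, add_sub_cancel_right]
  generalize trajectory stepA (fun _ => 1) u (n + 1) 0 = a
  generalize trajectory stepA (fun _ => 1) u (n + 1) 1 = b
  by_cases he : Even (n : ℤ) <;>
    simp only [he, if_true, if_false, not_true, not_false_eq_true] <;>
    · revert a b
      decide

lemma densityC_eq (n : ℕ) : densityC n = ((4 : ℝ) ^ n)⁻¹ * walkCount n 1 :=
  (particleProb_pointMass isLocal_stepC _ n).trans (cellProb_stepC_full n)

end PCA

/-! ### The theorem -/

theorem proposition4 (n : ℕ) :
    -- the supremum over the initial laws is a maximum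
    IsGreatest (Set.range fun μ : ProbabilityMeasure (ℤ → Fin 2) => PCA.equalPairProb μ n)
      (PCA.speedA n) ∧
    -- it is also the maximal particle density of model B
    IsGreatest (Set.range fun ν : ProbabilityMeasure (ℤ → PCA.Cell) =>
      PCA.particleProb PCA.stepB ν n) (PCA.speedA n) ∧
    -- the value of the particle density of model C started from the full configuration
    PCA.densityC n = ((4 : ℝ) ^ n)⁻¹ * (Nat.choose (2 * n + 1) n : ℝ) ∧
    -- the upper bound
    PCA.speedA n ≤ PCA.densityC n ∧
    -- the lower bound, reached from the configuration with all sites in state 1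
    (1 ≤ n →
      PCA.equalPairProb (PCA.pointMass fun _ => 1) n = 1 / 2 * PCA.densityC (n - 1) ∧
      1 / 2 * PCA.densityC (n - 1) ≤ PCA.speedA n) := by
  obtain ⟨y, hy⟩ := PCA.exists_cellProb_max PCA.isLocal_stepB n
  obtain ⟨x, rfl⟩ := PCA.exists_equalPairs_eq y
  have hA : IsGreatest
      (Set.range fun μ : ProbabilityMeasure (ℤ → Fin 2) => PCA.equalPairProb μ n)
      (PCA.cellProb PCA.stepB (PCA.equalPairs x) n) := by
    refine ⟨⟨PCA.pointMass x, PCA.equalPairProb_pointMass x n⟩, ?_⟩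
    rintro _ ⟨μ, rfl⟩
    exact PCA.real_prod_updateLaw_le _ (PCA.measurableSet_equalPair n) fun x' =>
      (PCA.equalPair_section x' n).le.trans (hy _)
  have hB : IsGreatest
      (Set.range fun ν : ProbabilityMeasure (ℤ → PCA.Cell) => PCA.particleProb PCA.stepB ν n)
      (PCA.cellProb PCA.stepB (PCA.equalPairs x) n) := by
    refine ⟨⟨PCA.pointMass _, PCA.particleProb_pointMass PCA.isLocal_stepB _ n⟩, ?_⟩
    rintro _ ⟨ν, rfl⟩
    exact PCA.real_prod_updateLaw_le _ (PCA.measurableSet_particle PCA.isLocal_stepB n) hy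
  have hs : PCA.speedA n = PCA.cellProb PCA.stepB (PCA.equalPairs x) n := hA.csSup_eq
  rw [hs]
  refine ⟨hA, hB, ?_, ?_, fun hn => ?_⟩
  · rw [PCA.densityC_eq]
    simp [PCA.walkCount, Nat.choose_symm_half]
  · exact (PCA.cellProb_stepB_le_stepC _ n).trans_eq
      (PCA.particleProb_pointMass PCA.isLocal_stepC _ n).symm
  · obtain ⟨m, rfl⟩ : ∃ m, n = m + 1 := ⟨n - 1, by omega⟩
    have h : PCA.equalPairProb (PCA.pointMass fun _ => 1) (m + 1) =
        1 / 2 * PCA.densityC m := by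
      rw [PCA.densityC_eq, ← PCA.updateLaw_equalPair_of_const_one]
      refine (PCA.real_dirac_prod_updateLaw _ (PCA.measurableSet_equalPair (m + 1))).trans ?_
      congr 1
      ext u
      exact PCA.equalPair_iff _ _
    exact ⟨h, h ▸ hA.2 ⟨_, rfl⟩⟩
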